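/- **Setting.** Images are rectangular grids of $N_I=n_1n_2$ pixels observed in $N_W\ge 1$ energy bands; two pixels are neighbours if they share a pixel edge. A *model* $\psi=(R,\mu)$ consists of a region assignment function $R:\{\text{pixels}\}\to\{1,\dots,m\}$ all of whose regions $R_h=R^{-1}(h)$ are nonempty and connected, and of rates $\mu_{h,w}>0$ ($1\le h\le m$, $1\le w\le N_W$). Let $a_h$ be the number of pixels of $R_h$ and $b_h$ the number of pixel edges between $R_h$ and other regions. For one image $x=(x_{i,w})$ put $l(\psi;x)=\sum_w\sum_h\sum_{i\in R_h}[x_{i,w}\log\mu_{h,w}-\mu_{h,w}]$. Let $\mathcal M$ be any class of models. For $\boldsymbol\nu=(\nu_1,\dots,\nu_K)$ put $\nu_0=0$, $\nu_{K+1}=1$; for $\epsilon_\nu>0$ let $A^K_{\epsilon_\nu}$ be the set of $\boldsymbol\nu\in(0,1)^K$ with $\nu_1<\dots<\nu_K$ and $\nu_k-\nu_{k-1}>\epsilon_\nu$ for $1\le k\le K+1$. Given images $\mathbf Y_1,\dots,\mathbf Y_{T}$ and $\boldsymbol\psi=(\psi_1,\dots,\psi_{K+1})$, write $m^{(k)},a^{(k)}_h,b^{(k)}_h$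 for the quantities belonging to $\psi_k$, and let $$\mathrm{MDL}(K,\boldsymbol\nu,\boldsymbol\psi)=K\log T+\sum_{k=1}^{K+1}\Big[m^{(k)}\log N_I+\frac{\log 3}{2}\sum_h b^{(k)}_h+\frac{N_W}{2}\sum_h\log\big(([T\nu_k]-[T\nu_{k-1}]+1)\,a_h^{(k)}\big)\Big]-\sum_{k=1}^{K+1}\ \sum_{[T\nu_{k-1}]<t\le[T\nu_k]} l(\psi_k;\mathbf Y_t),$$ where $[\cdot]$ is the integer part. **Theorem.** Let $K^o\ge 0$, $\boldsymbol\nu^o\in A^{K^o}_{\epsilon_\nu}$ and $\psi^o_1,\dots,\psi^o_{K^o+1}\in\mathcal M$, $\psi^o_k=(R^{o(k)},\mu^{o(k)})$. For every $T$ let the counts $y_{i,t,w}$ ($1\le t\le T$) of the images $\mathbf Y_t$ be independent, with $y_{i,t,w}\sim\mathrm{Poisson}(\mu^{o(k)}_{R^{o(k)}(i),w})$ for $[T\nu^o_{k-1}]<t\le[T\nu^o_k]$ (all defined on one probability space, with an arbitrary joint law for different $T$). Assume that 1. in every interval $k$, any two different neighbouring regions $p,q$ of $R^{o(k)}$ satisfy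 $\mu^{o(k)}_{p,w}\ne\mu^{o(k)}_{q,w}$ for all bands $w$; 2. for every $1\le k\le K^o$ there are a pixel $i$ and a band $w$ with $\mu^{o(k+1)}_{R^{o(k+1)}(i),w}\neq\mu^{o(k)}_{R^{o(k)}(i),w}$. Suppose that $K^o$ is known and that, almost surely for all sufficiently large $T$, $(\hat{\boldsymbol\nu}_T,\hat{\boldsymbol\psi}_T)$ is a minimizer of $\frac1T\mathrm{MDL}(K^o,\boldsymbol\nu,\boldsymbol\psi)$ over $\boldsymbol\nu\in A^{K^o}_{\epsilon_\nu}$ and $\boldsymbol\psi\in\mathcal M^{K^o+1}$. Then, almost surely, $\hat{\boldsymbol\nu}_T\to\boldsymbol\nu^o$ as $T\to\infty$, and for all sufficiently large $T$ and every $1\le k\le K^o+1$ the estimated segmentation $\hat R^{(k)}$ is equal to $R^{o(k)}$ (up to the labelling of the regions) or an oversegmentation of it, i.e. $\hat R^{(k)}(i)=\hat R^{(k)}(j)$ implies $R^{o(k)}(i)=R^{o(k)}(j)$ for all pixels $i,j$. -/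

import Mathlib

open scoped BigOperators

noncomputable section

namespace ImageSeries

/-- The pixels of a rectangular image. -/
abbrev Pixel (n₁ n₂ : ℕ) : Type := Fin n₁ × Fin n₂

/-- The grid graph: two pixels are neighbours if and only if they share a pixel edge. -/
def grid (n₁ n₂ : ℕ) : SimpleGraph (Pixel n₁ n₂) :=
  (SimpleGraph.pathGraph n₁).boxProd (SimpleGraph.pathGraph n₂)

/-- A piecewise constant multi-band image model `ψ = (R, μ)`: the image is partitioned by a
region assignment function `R` into `m` nonempty connected regions, and `μ h w` is the (positive)
Poisson rate of region `h` in the energy band `w`. -/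
structure Model (n₁ n₂ W : ℕ) where
  /-- number of regions -/
  m : ℕ
  /-- region assignment function -/
  R : Pixel n₁ n₂ → Fin m
  /-- every region is connected (in particular nonempty) -/
  connected : ∀ h : Fin m, ((grid n₁ n₂).induce {i | R i = h}).Connected
  /-- Poisson rates -/
  μ : Fin m → Fin W → ℝ
  /-- the rates are positive -/
  μ_pos : ∀ h w, 0 < μ h w

namespace Model

variable {n₁ n₂ W : ℕ}

/-- The set of pixels in the region `h`. -/
def region (ψ : Model n₁ n₂ W) (h : Fin ψ.m) : Finset (Pixel n₁ n₂) :=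
  Finset.univ.filter fun i => ψ.R i = h

/-- The area `a_h`: number of pixels of the region `h`. -/
def area (ψ : Model n₁ n₂ W) (h : Fin ψ.m) : ℕ := (ψ.region h).card

/-- The perimeter `b_h`: number of pixel edges between the region `h` and the other regions. -/
def perimeter (ψ : Model n₁ n₂ W) (h : Fin ψ.m) : ℕ :=
  {p : Pixel n₁ n₂ × Pixel n₁ n₂ | (grid n₁ n₂).Adj p.1 p.2 ∧ ψ.R p.1 = h ∧ ψ.R p.2 ≠ h}.ncard

/-- Two different regions are neighbouring if some pixel of one is a neighbour of some pixel of
the other. -/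
def NeighbouringRegions (ψ : Model n₁ n₂ W) (p q : Fin ψ.m) : Prop :=
  p ≠ q ∧ ∃ i j, (grid n₁ n₂).Adj i j ∧ ψ.R i = p ∧ ψ.R j = q

/-- The log-likelihood `l(ψ; x)` of one multi-band image `x` (without the terms that do not depend
on the parameters). -/
def logLik (ψ : Model n₁ n₂ W) (x : Pixel n₁ n₂ → Fin W → ℕ) : ℝ :=
  ∑ w : Fin W, ∑ h : Fin ψ.m, ∑ i ∈ ψ.region h, ((x i w : ℝ) * Real.log (ψ.μ h w) - ψ.μ h w)

/-- The segmentation of `b` is an oversegmentation compared with that of `s` (equality of the two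
partitions is allowed). -/
def Oversegments (b s : Model n₁ n₂ W) : Prop :=
  ∀ i j, b.R i = b.R j → s.R i = s.R j

end Model

/-- The normalized change points `ν₁, …, ν_K` together with `ν₀ = 0` and `ν_{K+1} = 1`. -/
def extend {K : ℕ} (ν : Fin K → ℝ) : Fin (K + 2) → ℝ :=
  Fin.cons (α := fun _ => ℝ) 0 (Fin.snoc (α := fun _ => ℝ) ν 1)

/-- The constraint set `A_ε^K` for the normalized change points. -/
def admissible (K : ℕ) (ε : ℝ) : Set (Fin K → ℝ) :=
  {ν | (∀ k, 0 < ν k ∧ ν k < 1) ∧ StrictMono ν ∧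
    ∀ k : Fin (K + 1), ε < extend ν k.succ - extend ν k.castSucc}

/-- The change points `τ_k = [T ν_k]`, `0 ≤ k ≤ K + 1`, for `T` time bins. -/
def changePoint {K : ℕ} (T : ℕ) (ν : Fin K → ℝ) (k : Fin (K + 2)) : ℕ :=
  ⌊(T : ℝ) * extend ν k⌋₊

/-- The time bins `t ∈ (τ_{k-1}, τ_k]` of an interval; the index `k : Fin (K + 1)` starts at `0`. -/
def interval {K : ℕ} (T : ℕ) (ν : Fin K → ℝ) (k : Fin (K + 1)) : Finset ℕ :=
  Finset.Ioc (changePoint T ν k.castSucc) (changePoint T ν k.succ)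

/-- The code length of the parameters of one model that is fitted on an interval whose end points
differ by `len`. -/
def penalty {n₁ n₂ W : ℕ} (ψ : Model n₁ n₂ W) (len : ℝ) : ℝ :=
  (ψ.m : ℝ) * Real.log ((n₁ * n₂ : ℕ) : ℝ)
    + Real.log 3 / 2 * ∑ h : Fin ψ.m, (ψ.perimeter h : ℝ)
    + (W : ℝ) / 2 * ∑ h : Fin ψ.m, Real.log ((len + 1) * (ψ.area h : ℝ))

/-- The criterion `MDL(K, ν, ψ)` for the images `Y t`, `1 ≤ t ≤ T`. -/
def mdl {n₁ n₂ W K : ℕ} (T : ℕ) (Y : ℕ → Pixel n₁ n₂ → Fin W → ℕ)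
    (ν : Fin K → ℝ) (ψ : Fin (K + 1) → Model n₁ n₂ W) : ℝ :=
  (K : ℝ) * Real.log (T : ℝ)
    + ∑ k : Fin (K + 1),
        penalty (ψ k) ((changePoint T ν k.succ : ℝ) - (changePoint T ν k.castSucc : ℝ))
    - ∑ k : Fin (K + 1), ∑ t ∈ interval T ν k, (ψ k).logLik (Y t)

/-- `(ν, ψ)` minimizes `MDL(K, ·, ·) / T` over the admissible change points and over the models
from the class `𝓜`, the number `K` of change points being fixed. -/
def IsMDLEstimate {n₁ n₂ W K : ℕ} (ε : ℝ) (𝓜 : Set (Model n₁ n₂ W)) (T : ℕ)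
    (Y : ℕ → Pixel n₁ n₂ → Fin W → ℕ) (ν : Fin K → ℝ) (ψ : Fin (K + 1) → Model n₁ n₂ W) : Prop :=
  (ν ∈ admissible K ε ∧ ∀ k, ψ k ∈ 𝓜) ∧
    ∀ ν' ∈ admissible K ε, ∀ ψ' : Fin (K + 1) → Model n₁ n₂ W, (∀ k, ψ' k ∈ 𝓜) →
      1 / (T : ℝ) * mdl T Y ν ψ ≤ 1 / (T : ℝ) * mdl T Y ν' ψ'

open MeasureTheory ProbabilityTheory in
/-- `y T t i w` (`1 ≤ t ≤ T`) are, for every number `T` of time bins, independent Poisson counts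
that follow the model with the normalized change points `ν` and the parameters `ψ`. Nothing is
required of the joint law of the arrays for different `T`. -/
structure IsObserved {Ω : Type*} [MeasurableSpace Ω] (P : Measure Ω) {n₁ n₂ W K : ℕ}
    (ν : Fin K → ℝ) (ψ : Fin (K + 1) → Model n₁ n₂ W)
    (y : ℕ → ℕ → Pixel n₁ n₂ → Fin W → Ω → ℕ) : Prop where
  indep : ∀ T : ℕ, iIndepFun
    (fun p : Finset.Icc 1 T × Pixel n₁ n₂ × Fin W => y T (p.1 : ℕ) p.2.1 p.2.2) P
  law : ∀ (T : ℕ) (k : Fin (K + 1)), ∀ t ∈ interval T ν k, ∀ i w,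
    HasLaw (y T t i w) (poissonMeasure (Real.toNNReal ((ψ k).μ ((ψ k).R i) w))) P

end ImageSeries

end

/-!
The penalty is of order `log T`, so that `-MDL / T` is the average log-likelihood up to `o(1)`. By
Chernoff's bound and the Borel-Cantelli lemma, almost surely the averages of the counts over all
initial segments with rational end points converge; as these averages are monotone in the end point,
they converge along any convergent sequence of change points.

By compactness the estimated change points may be assumed to converge. The likelihood of a limiting
interval that meets true intervals with different rates falls short of the likelihood of the true
model by a sum of Kullback-Leibler divergences, which a minimizer cannot afford. Hence in every
pixel the estimated rate of an interval converges to the true rate of each true interval that it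
overlaps, and no limiting interval can contain a true change point in its interior. As the numbers
of intervals agree, the limiting change points are the true ones. Finally, neighbouring pixels of
different true regions eventually have different estimated rates, so they lie in different estimated
regions, and a connected estimated region cannot leave a true region.
-/

noncomputable section

open MeasureTheory ProbabilityTheory Filter Topology
open scoped NNReal ENNReal

namespace ImageSeries

section LawOfLargeNumbers

variable {Ω Ω' ι : Type*} [MeasurableSpace Ω] [MeasurableSpace Ω'] {P : Measure Ω}
  {Q : Measure Ω'} {X : Ω' → ℝ}

lemma exists_pos_cgf_lt [IsProbabilityMeasure Q] (hX : 0 ∈ interior (integrableExpSet X Q)) {a : ℝ}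
    (ha : Q[X] < a) : ∃ θ > 0, θ ∈ integrableExpSet X Q ∧ cgf X Q θ < θ * a := by
  have hderiv : HasDerivAt (cgf X Q) Q[X] 0 := by
    have h := (analyticAt_cgf hX).differentiableAt.hasDerivAt
    rwa [deriv_cgf_zero hX, probReal_univ, div_one] at h
  have hslope : ∀ᶠ θ in 𝓝[>] (0 : ℝ), slope (cgf X Q) 0 θ < a :=
    (hderiv.tendsto_slope.mono_left (nhdsGT_le_nhdsNE 0)).eventually_lt_const ha
  have hmem : ∀ᶠ θ in 𝓝[>] (0 : ℝ), θ ∈ integrableExpSet X Q :=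
    nhdsWithin_le_nhds (mem_interior_iff_mem_nhds.1 hX)
  obtain ⟨θ, ⟨hθ, hθX⟩, hθ0⟩ := ((hslope.and hmem).and self_mem_nhdsWithin).exists
  refine ⟨θ, hθ0, hθX, ?_⟩
  rwa [slope_def_field, cgf_zero, sub_zero, sub_zero, div_lt_iff₀' hθ0] at hθ

lemma measureReal_add_mul_le_sum_le [Fintype ι] [IsProbabilityMeasure P]
    [IsProbabilityMeasure Q] {Z : ι → Ω → ℝ}
    (hind : iIndepFun Z P) (hident : ∀ t, IdentDistrib (Z t) X P Q) {θ a δ N : ℝ} (hθ : 0 ≤ θ)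
    (hint : θ ∈ integrableExpSet X Q) (hδ : 0 ≤ δ) (hcgf : cgf X Q θ ≤ θ * (a + δ))
    (hN : Fintype.card ι ≤ N) :
    P.real {ω | Fintype.card ι * a + 2 * δ * N ≤ ∑ t, Z t ω} ≤ Real.exp (-(θ * δ * N)) := by
  have hmgf : mgf (∑ t, Z t) P θ = mgf X Q θ ^ Fintype.card ι := by
    rw [hind.mgf_sum₀ fun t => (hident t).aemeasurable_fst,
      Finset.prod_congr rfl fun t _ => mgf_congr_of_identDistrib (Z t) X (hident t) θ,
      Finset.prod_const, Finset.card_univ]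
  have hpos : 0 < mgf (∑ t, Z t) P θ := hmgf ▸ pow_pos (mgf_pos hint) _
  have hchernoff := measure_ge_le_exp_cgf (Fintype.card ι * a + 2 * δ * N) hθ
    (not_imp_comm.1 integral_undef hpos.ne')
  rw [cgf, hmgf, Real.log_pow, ← cgf] at hchernoff
  simp only [Finset.sum_apply] at hchernoff
  refine hchernoff.trans (Real.exp_le_exp.2 ?_)
  have := mul_le_mul_of_nonneg_left hcgf (Nat.cast_nonneg' (α := ℝ) (Fintype.card ι))
  have := mul_le_mul_of_nonneg_left hN (mul_nonneg hθ hδ)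
  linarith

variable [IsProbabilityMeasure P] [IsProbabilityMeasure Q] {Z : ℕ → ι → Ω → ℝ} {s : ℕ → Finset ι}

lemma ae_eventually_sum_lt (hX : 0 ∈ interior (integrableExpSet X Q))
    (hind : ∀ T, iIndepFun (fun t : s T => Z T t) P)
    (hident : ∀ T, ∀ t ∈ s T, IdentDistrib (Z T t) X P Q) (hcard : ∀ T, (s T).card ≤ T)
    {δ : ℝ} (hδ : 0 < δ) :
    ∀ᵐ ω ∂P, ∀ᶠ T : ℕ in atTop, ∑ t ∈ s T, Z T t ω < (s T).card * Q[X] + δ * T := by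
  obtain ⟨θ, hθ, hint, hcgf⟩ := exists_pos_cgf_lt hX (lt_add_of_pos_right Q[X] (half_pos hδ))
  have htail : ∀ T : ℕ, P.real {ω | (s T).card * Q[X] + δ * T ≤ ∑ t ∈ s T, Z T t ω}
      ≤ Real.exp (-(θ * (δ / 2))) ^ T := fun T => by
    have h := measureReal_add_mul_le_sum_le (hind T) (fun t => hident T t t.2) hθ.le hint
      (half_pos hδ).le hcgf.le (N := T) (by simpa using hcard T)
    simp only [Fintype.card_coe, mul_div_cancel₀ δ two_ne_zero] at h
    simp only [fun ω => Finset.sum_coe_sort (s T) (Z T · ω)] at h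
    rwa [← Real.exp_nat_mul, mul_neg, mul_comm (T : ℝ)]
  have hsum : Summable fun T : ℕ =>
      P.real {ω | (s T).card * Q[X] + δ * T ≤ ∑ t ∈ s T, Z T t ω} :=
    .of_nonneg_of_le (fun _ => measureReal_nonneg) htail <|
      summable_geometric_of_lt_one (Real.exp_pos _).le (Real.exp_lt_one_iff.2 (by
        simpa using mul_pos hθ (half_pos hδ)))
  have hfin : ∑' T : ℕ, P {ω | (s T).card * Q[X] + δ * T ≤ ∑ t ∈ s T, Z T t ω} ≠ ∞ := by
    simpa only [ofReal_measureReal (measure_ne_top P _)] using hsum.tsum_ofReal_ne_top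
  filter_upwards [ae_eventually_notMem hfin] with ω hω
  exact hω.mono fun T hT => not_le.1 hT

theorem ae_tendsto_sum_sub_div (hX : 0 ∈ interior (integrableExpSet X Q))
    (hind : ∀ T, iIndepFun (fun t : s T => Z T t) P)
    (hident : ∀ T, ∀ t ∈ s T, IdentDistrib (Z T t) X P Q) (hcard : ∀ T, (s T).card ≤ T) :
    ∀ᵐ ω ∂P, Tendsto (fun T : ℕ => (∑ t ∈ s T, Z T t ω - (s T).card * Q[X]) / T) atTop (𝓝 0) := by
  have hX' : 0 ∈ interior (integrableExpSet (-X) Q) := by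
    simp only [mem_interior_iff_mem_nhds, integrableExpSet] at hX ⊢
    filter_upwards [(continuous_neg (G := ℝ)).tendsto' 0 0 neg_zero hX] with θ hθ
    simpa only [Set.mem_preimage, Set.mem_ofPred_eq, Pi.neg_apply, mul_neg, neg_mul] using hθ
  have hupper : ∀ᵐ ω ∂P, ∀ n : ℕ, ∀ᶠ T : ℕ in atTop,
      ∑ t ∈ s T, Z T t ω < (s T).card * Q[X] + 1 / ((n : ℝ) + 1) * T :=
    ae_all_iff.2 fun n => ae_eventually_sum_lt hX hind hident hcard Nat.one_div_pos_of_nat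
  have hlower : ∀ᵐ ω ∂P, ∀ n : ℕ, ∀ᶠ T : ℕ in atTop,
      ∑ t ∈ s T, -Z T t ω < (s T).card * Q[-X] + 1 / ((n : ℝ) + 1) * T :=
    ae_all_iff.2 fun n => ae_eventually_sum_lt (Z := fun T t ω => -Z T t ω) hX'
      (fun T => (hind T).comp (fun _ x => -x) fun _ => measurable_neg)
      (fun T t ht => (hident T t ht).comp measurable_neg) hcard Nat.one_div_pos_of_nat
  filter_upwards [hupper, hlower] with ω hup hlow
  refine Metric.tendsto_nhds.2 fun η hη => ?_
  obtain ⟨n, hn⟩ := exists_nat_one_div_lt hη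
  filter_upwards [hup n, hlow n, eventually_gt_atTop 0] with T h₁ h₂ hT
  have hT' : (0 : ℝ) < T := Nat.cast_pos.2 hT
  simp only [Pi.neg_apply, integral_neg, Finset.sum_neg_distrib] at h₂
  rw [Real.dist_eq, sub_zero, abs_div, abs_of_pos hT', div_lt_iff₀ hT']
  refine (abs_lt.2 ⟨?_, ?_⟩).trans (mul_lt_mul_of_pos_right hn hT') <;> linarith

end LawOfLargeNumbers

section Poisson

lemma hasSum_exp_mul_poissonMeasure (r : ℝ≥0) (θ : ℝ) :
    HasSum (fun n : ℕ => Real.exp (-r) * r ^ n / n.factorial * Real.exp (θ * n))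
      (Real.exp (r * (Real.exp θ - 1))) := by
  have h := (NormedSpace.expSeries_div_hasSum_exp (𝔸 := ℝ) (r * Real.exp θ)).mul_left
    (Real.exp (-r))
  rw [← Real.exp_eq_exp_ℝ, ← Real.exp_add,
    show -(r : ℝ) + r * Real.exp θ = r * (Real.exp θ - 1) by ring] at h
  refine h.congr_fun fun n => ?_
  rw [mul_pow, ← Real.exp_nat_mul, mul_comm (n : ℝ) θ]
  ring

lemma integrable_exp_mul_poissonMeasure (r : ℝ≥0) (θ : ℝ) :
    Integrable (fun n : ℕ => Real.exp (θ * n)) (poissonMeasure r) := by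
  rw [integrable_poissonMeasure_iff]
  simpa only [Real.norm_eq_abs, Real.abs_exp] using (hasSum_exp_mul_poissonMeasure r θ).summable

lemma mgf_poissonMeasure (r : ℝ≥0) :
    mgf (fun n : ℕ => (n : ℝ)) (poissonMeasure r) = fun θ => Real.exp (r * (Real.exp θ - 1)) :=
  funext fun θ => (hasSum_integral_poissonMeasure (integrable_exp_mul_poissonMeasure r θ)).unique
    (hasSum_exp_mul_poissonMeasure r θ)

lemma integrableExpSet_poissonMeasure (r : ℝ≥0) :
    integrableExpSet (fun n : ℕ => (n : ℝ)) (poissonMeasure r) = Set.univ :=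
  Set.eq_univ_of_forall (integrable_exp_mul_poissonMeasure r)

lemma zero_mem_interior_integrableExpSet_poissonMeasure (r : ℝ≥0) :
    0 ∈ interior (integrableExpSet (fun n : ℕ => (n : ℝ)) (poissonMeasure r)) := by
  simp only [integrableExpSet_poissonMeasure, interior_univ, Set.mem_univ]

lemma integral_natCast_poissonMeasure (r : ℝ≥0) : ∫ n : ℕ, (n : ℝ) ∂poissonMeasure r = r := by
  have hderiv : HasDerivAt (fun θ : ℝ => Real.exp (r * (Real.exp θ - 1))) r 0 := by
    simpa using (((Real.hasDerivAt_exp 0).sub_const 1).const_mul (r : ℝ)).exp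
  rw [← deriv_mgf_zero (zero_mem_interior_integrableExpSet_poissonMeasure r), mgf_poissonMeasure,
    hderiv.deriv]

end Poisson

section PoissonLikelihood

/-- The Kullback-Leibler divergence of the Poisson law with rate `x` from the one with rate `r`. -/
def poissonDiv (x r : ℝ) : ℝ := x * Real.log (x / r) - x + r

lemma sq_sqrt_sub_sqrt_le_poissonDiv {x r : ℝ} (hx : 0 ≤ x) (hr : 0 < r) :
    (√x - √r) ^ 2 ≤ poissonDiv x r := by
  rcases hx.eq_or_lt with rfl | hx
  · simp [poissonDiv, Real.sq_sqrt hr.le]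
  have hlog : 2 * (1 - √r / √x) ≤ Real.log (x / r) := by
    have h := Real.one_sub_inv_le_log_of_pos (Real.sqrt_pos.2 (div_pos hx hr))
    rw [Real.log_sqrt (div_pos hx hr).le, Real.sqrt_div' x hr.le, inv_div] at h
    linarith
  have hxr : x * (√r / √x) = √x * √r := by
    rw [mul_div_left_comm, Real.div_sqrt, mul_comm]
  calc (√x - √r) ^ 2 = x * (2 * (1 - √r / √x)) - x + r := by
        rw [sub_sq, Real.sq_sqrt hx.le, Real.sq_sqrt hr.le]
        linear_combination 2 * hxr
    _ ≤ x * Real.log (x / r) - x + r := by gcongr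

lemma poissonDiv_nonneg {x r : ℝ} (hx : 0 ≤ x) (hr : 0 < r) : 0 ≤ poissonDiv x r :=
  (sq_nonneg _).trans (sq_sqrt_sub_sqrt_le_poissonDiv hx hr)

lemma eq_of_poissonDiv_eq_zero {x r : ℝ} (hx : 0 ≤ x) (hr : 0 < r) (h : poissonDiv x r = 0) :
    x = r :=
  (Real.sqrt_inj hx hr.le).1 <| sub_eq_zero.1 <| pow_eq_zero_iff two_ne_zero |>.1 <|
    (h ▸ sq_sqrt_sub_sqrt_le_poissonDiv hx hr).antisymm (sq_nonneg _)

lemma tendsto_of_tendsto_poissonDiv_zero {α : Type*} {F : Filter α} {x r : α → ℝ} {ρ : ℝ}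
    (hx₀ : ∀ᶠ a in F, 0 ≤ x a) (hr : ∀ᶠ a in F, 0 < r a) (hρ : 0 ≤ ρ) (hx : Tendsto x F (𝓝 ρ))
    (h : Tendsto (fun a => poissonDiv (x a) (r a)) F (𝓝 0)) : Tendsto r F (𝓝 ρ) := by
  have hsq : Tendsto (fun a => (√(x a) - √(r a)) ^ 2) F (𝓝 0) :=
    squeeze_zero' (.of_forall fun _ => sq_nonneg _)
      (by filter_upwards [hx₀, hr] with a using sq_sqrt_sub_sqrt_le_poissonDiv) h
  have hdiff : Tendsto (fun a => √(x a) - √(r a)) F (𝓝 0) := by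
    rw [tendsto_zero_iff_abs_tendsto_zero]
    simpa only [Function.comp_def, Real.sqrt_sq_eq_abs, Real.sqrt_zero] using hsq.sqrt
  have hlim := (hx.sqrt.sub hdiff).pow 2
  rw [sub_zero, Real.sq_sqrt hρ] at hlim
  refine hlim.congr' (hr.mono fun a ha => ?_)
  rw [sub_sub_cancel, Real.sq_sqrt ha.le]

/-- The log-likelihood of the rate `r` for `n` Poisson counts with sum `s`, up to a term that does
not depend on `r`. The number `n` is real so that it can be rescaled. -/
def poissonLogLik (n s r : ℝ) : ℝ := s * Real.log r - n * r

lemma poissonLogLik_mul_self_sub (n : ℝ) {x r : ℝ} (hx : 0 ≤ x) (hr : 0 < r) :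
    poissonLogLik n (n * x) x - poissonLogLik n (n * x) r = n * poissonDiv x r := by
  unfold poissonLogLik poissonDiv
  rcases hx.eq_or_lt with rfl | hx
  · simp
  rw [Real.log_div hx.ne' hr.ne']
  ring

lemma poissonLogLik_div_sub {n s r : ℝ} (hn : 0 < n) (hs : 0 ≤ s) (hr : 0 < r) :
    poissonLogLik n s (s / n) - poissonLogLik n s r = n * poissonDiv (s / n) r := by
  rw [← poissonLogLik_mul_self_sub n (div_nonneg hs hn.le) hr, mul_div_cancel₀ s hn.ne']

lemma poissonLogLik_sum {ι : Type*} (I : Finset ι) (n s : ι → ℝ) (r : ℝ) :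
    poissonLogLik (∑ i ∈ I, n i) (∑ i ∈ I, s i) r = ∑ i ∈ I, poissonLogLik (n i) (s i) r := by
  simp only [poissonLogLik, Finset.sum_mul, Finset.sum_sub_distrib]

lemma eq_zero_and_tendsto_zero_of_sum_le {α ι : Type*} [Fintype ι] {F : Filter α} [F.NeBot]
    {f : α → ι → ℝ} {g : α → ℝ} {c : ℝ} (hf : ∀ᶠ a in F, ∀ i, 0 ≤ f a i)
    (hfg : ∀ᶠ a in F, ∑ i, f a i ≤ g a) (hg : Tendsto g F (𝓝 c)) (hc : c ≤ 0) :
    c = 0 ∧ ∀ i, Tendsto (fun a => f a i) F (𝓝 0) := by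
  have hc₀ : c = 0 := hc.antisymm <| ge_of_tendsto hg <| by
    filter_upwards [hf, hfg] with a h₀ h using (Finset.sum_nonneg fun i _ => h₀ i).trans h
  refine ⟨hc₀, fun i => squeeze_zero' (hf.mono fun a h₀ => h₀ i) ?_ (hc₀ ▸ hg)⟩
  filter_upwards [hf, hfg] with a h₀ h
  exact (Finset.single_le_sum (fun i _ => h₀ i) (Finset.mem_univ i)).trans h

variable {α ι κ : Type*} [Fintype ι] {F : Filter α} [F.NeBot] {n s r : α → ι → ℝ} {B : α → ℝ}

lemma tendsto_rate_of_le_sum_poissonLogLik {N S : ι → ℝ} {b : ℝ} (hN : ∀ i, 0 < N i)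
    (hS : ∀ i, 0 < S i) (hn : ∀ i, Tendsto (fun a => n a i) F (𝓝 (N i)))
    (hs : ∀ i, Tendsto (fun a => s a i) F (𝓝 (S i))) (hr : ∀ᶠ a in F, ∀ i, 0 < r a i)
    (hB : Tendsto B F (𝓝 b)) (hb : ∑ i, poissonLogLik (N i) (S i) (S i / N i) ≤ b)
    (hle : ∀ᶠ a in F, B a ≤ ∑ i, poissonLogLik (n a i) (s a i) (r a i)) :
    b = ∑ i, poissonLogLik (N i) (S i) (S i / N i) ∧
      ∀ i, Tendsto (fun a => r a i) F (𝓝 (S i / N i)) := by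
  have hx : ∀ i, Tendsto (fun a => s a i / n a i) F (𝓝 (S i / N i)) := fun i =>
    (hs i).div (hn i) (hN i).ne'
  have hn₀ : ∀ᶠ a in F, ∀ i, 0 < n a i :=
    eventually_all.2 fun i => (hn i).eventually_const_lt (hN i)
  have hs₀ : ∀ᶠ a in F, ∀ i, 0 ≤ s a i :=
    eventually_all.2 fun i => ((hs i).eventually_const_lt (hS i)).mono fun _ => le_of_lt
  have hgap : Tendsto (fun a => ∑ i, poissonLogLik (n a i) (s a i) (s a i / n a i) - B a) F
      (𝓝 (∑ i, poissonLogLik (N i) (S i) (S i / N i) - b)) :=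
    (tendsto_finsetSum _ fun i _ => ((hs i).mul ((hx i).log (div_pos (hS i) (hN i)).ne')).sub
      ((hn i).mul (hx i))).sub hB
  obtain ⟨hzero, hdiv⟩ := eq_zero_and_tendsto_zero_of_sum_le
    (f := fun a i => n a i * poissonDiv (s a i / n a i) (r a i))
    (by filter_upwards [hn₀, hs₀, hr] with a hn₀ hs₀ hr i using mul_nonneg (hn₀ i).le
          (poissonDiv_nonneg (div_nonneg (hs₀ i) (hn₀ i).le) (hr i)))
    (by filter_upwards [hle, hn₀, hs₀, hr] with a hle hn₀ hs₀ hr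
        simp only [← poissonLogLik_div_sub (hn₀ _) (hs₀ _) (hr _), Finset.sum_sub_distrib]
        exact sub_le_sub_left hle _)
    hgap (sub_nonpos.2 hb)
  refine ⟨(sub_eq_zero.1 hzero).symm, fun i => tendsto_of_tendsto_poissonDiv_zero ?_
    (hr.mono fun a hr => hr i) (div_pos (hS i) (hN i)).le (hx i) ?_⟩
  · filter_upwards [hn₀, hs₀] with a hn₀ hs₀ using div_nonneg (hs₀ i) (hn₀ i).le
  · have h := (hdiv i).div (hn i) (hN i).ne'
    rw [zero_div] at h
    exact h.congr' (hn₀.mono fun a hn₀ => mul_div_cancel_left₀ _ (hn₀ i).ne')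

-- A group that mixes counts of different rates loses at least the sum of the divergences of these
-- rates from the pooled rate, and the likelihood of the true rates leaves no room for a loss.
theorem tendsto_rate_of_le_sum_poissonLogLik_of_mixture [Fintype κ] {o lam : ι → κ → ℝ}
    (ho : ∀ i j, 0 ≤ o i j) (hlam : ∀ i j, 0 < lam i j) (hpos : ∀ i, 0 < ∑ j, o i j)
    (hn : ∀ i, Tendsto (fun a => n a i) F (𝓝 (∑ j, o i j)))
    (hs : ∀ i, Tendsto (fun a => s a i) F (𝓝 (∑ j, o i j * lam i j)))
    (hr : ∀ᶠ a in F, ∀ i, 0 < r a i)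
    (hB : Tendsto B F (𝓝 (∑ i, ∑ j, poissonLogLik (o i j) (o i j * lam i j) (lam i j))))
    (hle : ∀ᶠ a in F, B a ≤ ∑ i, poissonLogLik (n a i) (s a i) (r a i)) {i : ι} {j : κ}
    (hij : 0 < o i j) : Tendsto (fun a => r a i) F (𝓝 (lam i j)) := by
  have hS : ∀ i, 0 < ∑ j, o i j * lam i j := fun i => by
    obtain ⟨j, -, hj⟩ := (Finset.sum_pos_iff_of_nonneg fun j _ => ho i j).1 (hpos i)
    exact (Finset.sum_pos_iff_of_nonneg fun j _ => mul_nonneg (ho i j) (hlam i j).le).2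
      ⟨j, Finset.mem_univ j, mul_pos hj (hlam i j)⟩
  set ρ : ι → ℝ := fun i => (∑ j, o i j * lam i j) / ∑ j, o i j
  have hρ : ∀ i, 0 < ρ i := fun i => div_pos (hS i) (hpos i)
  have hloss_nonneg : ∀ i j, 0 ≤ o i j * poissonDiv (lam i j) (ρ i) := fun i j =>
    mul_nonneg (ho i j) (poissonDiv_nonneg (hlam i j).le (hρ i))
  have hloss : ∑ i, ∑ j, poissonLogLik (o i j) (o i j * lam i j) (lam i j)
      - ∑ i, poissonLogLik (∑ j, o i j) (∑ j, o i j * lam i j) (ρ i)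
      = ∑ i, ∑ j, o i j * poissonDiv (lam i j) (ρ i) := by
    simp only [poissonLogLik_sum, ← poissonLogLik_mul_self_sub _ (hlam _ _).le (hρ _),
      Finset.sum_sub_distrib]
  have hloss_sum_nonneg : ∀ i, 0 ≤ ∑ j, o i j * poissonDiv (lam i j) (ρ i) := fun i =>
    Finset.sum_nonneg fun j _ => hloss_nonneg i j
  obtain ⟨hmax, hlim⟩ := tendsto_rate_of_le_sum_poissonLogLik hpos hS hn hs hr hB
    (sub_nonneg.1 (hloss ▸ Finset.sum_nonneg fun i _ => hloss_sum_nonneg i)) hle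
  rw [hmax, sub_self, eq_comm, Finset.sum_eq_zero_iff_of_nonneg fun i _ => hloss_sum_nonneg i]
    at hloss
  have hzero : o i j * poissonDiv (lam i j) (ρ i) = 0 :=
    (Finset.sum_eq_zero_iff_of_nonneg fun j _ => hloss_nonneg i j).1
      (hloss i (Finset.mem_univ i)) j (Finset.mem_univ j)
  rw [eq_of_poissonDiv_eq_zero (hlam i j).le (hρ i) ((mul_eq_zero.1 hzero).resolve_left hij.ne')]
  exact hlim i

end PoissonLikelihood

section Segmentations

lemma sum_fin_succ_sub_castSucc {M : Type*} [AddCommGroup M] {n : ℕ} (g : Fin (n + 1) → M) :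
    ∑ j : Fin n, (g j.succ - g j.castSucc) = g (Fin.last n) - g 0 := by
  rw [Finset.sum_sub_distrib, sub_eq_sub_iff_add_eq_add, add_comm, ← Fin.sum_univ_succ,
    Fin.sum_univ_castSucc, add_comm]

variable {n : ℕ}

lemma mem_range_or_exists_mem_Ioo {α : Type*} [LinearOrder α] {e : Fin (n + 1) → α} {x : α}
    (h₀ : e 0 ≤ x) (h₁ : x ≤ e (Fin.last n)) :
    x ∈ Set.range e ∨ ∃ k : Fin n, x ∈ Set.Ioo (e k.castSucc) (e k.succ) := by
  by_contra! hcon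
  obtain ⟨hrange, hIoo⟩ := hcon
  have hlt : ∀ k, e k < x := Fin.induction (h₀.lt_of_ne fun h => hrange ⟨0, h⟩) fun k hk =>
    (not_lt.1 fun hx => hIoo k ⟨hk, hx⟩).lt_of_ne fun h => hrange ⟨_, h⟩
  exact (hlt (Fin.last n)).not_ge h₁

/-- The length of the part of the interval `(e j, e (j + 1)]` that lies before `u`. -/
def lengthUpTo (e : Fin (n + 1) → ℝ) (j : Fin n) (u : ℝ) : ℝ :=
  min u (e j.succ) - min u (e j.castSucc)

/-- The length of the intersection of the interval `j` of `e` with the interval `k` of `e'`. -/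
def overlap (e : Fin (n + 1) → ℝ) (j : Fin n) {n' : ℕ} (e' : Fin (n' + 1) → ℝ) (k : Fin n') : ℝ :=
  lengthUpTo e j (e' k.succ) - lengthUpTo e j (e' k.castSucc)

lemma continuous_lengthUpTo (e : Fin (n + 1) → ℝ) (j : Fin n) : Continuous (lengthUpTo e j) := by
  unfold lengthUpTo
  fun_prop

lemma sum_lengthUpTo (e : Fin (n + 1) → ℝ) (u : ℝ) :
    ∑ j, lengthUpTo e j u = min u (e (Fin.last n)) - min u (e 0) :=
  sum_fin_succ_sub_castSucc fun j => min u (e j)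

variable {n' : ℕ} {e : Fin (n + 1) → ℝ} {e' : Fin (n' + 1) → ℝ}

lemma monotone_lengthUpTo (he : Monotone e) (j : Fin n) : Monotone (lengthUpTo e j) := by
  intro u v huv
  have := he j.castSucc_lt_succ.le
  unfold lengthUpTo
  grind

lemma overlap_nonneg (he : Monotone e) (he' : Monotone e') (j : Fin n) (k : Fin n') :
    0 ≤ overlap e j e' k :=
  sub_nonneg.2 (monotone_lengthUpTo he j (he' k.castSucc_lt_succ.le))

lemma overlap_pos {j : Fin n} {k : Fin n'}
    (h : max (e j.castSucc) (e' k.castSucc) < min (e j.succ) (e' k.succ)) :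
    0 < overlap e j e' k := by
  unfold overlap lengthUpTo
  grind

lemma overlap_self (he : Monotone e) (j k : Fin n) :
    overlap e j e k = if j = k then e k.succ - e k.castSucc else 0 := by
  have := he j.castSucc_lt_succ.le
  have := he k.castSucc_lt_succ.le
  unfold overlap lengthUpTo
  obtain hjk | rfl | hkj := lt_trichotomy j k
  · have := he (Fin.succ_le_castSucc_iff.2 hjk)
    grind
  · grind
  · have := he (Fin.succ_le_castSucc_iff.2 hkj)
    grind

lemma sum_overlap (he' : Monotone e') (h₀ : e 0 ≤ e' 0)
    (h₁ : e' (Fin.last n') ≤ e (Fin.last n)) (k : Fin n') :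
    ∑ j, overlap e j e' k = e' k.succ - e' k.castSucc := by
  have hsum : ∀ m, ∑ j, lengthUpTo e j (e' m) = e' m - e 0 := fun m => by
    rw [sum_lengthUpTo, min_eq_left ((he' (Fin.le_last m)).trans h₁),
      min_eq_right (h₀.trans (he' (Fin.zero_le m)))]
  simp only [overlap, Finset.sum_sub_distrib, hsum, sub_sub_sub_cancel_right]

lemma sum_overlap_right (he : Monotone e) (h₀ : e' 0 ≤ e 0)
    (h₁ : e (Fin.last n) ≤ e' (Fin.last n')) (j : Fin n) :
    ∑ k, overlap e j e' k = e j.succ - e j.castSucc := by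
  have hle : ∀ m, e m ≤ e' (Fin.last n') := fun m => (he (Fin.le_last m)).trans h₁
  have hge : ∀ m, e' 0 ≤ e m := fun m => h₀.trans (he (Fin.zero_le m))
  unfold overlap
  rw [sum_fin_succ_sub_castSucc fun k => lengthUpTo e j (e' k)]
  simp only [lengthUpTo, min_eq_right (hle _), min_eq_left (hge _), sub_self, sub_zero]

theorem eq_of_forall_overlap_nonpos {e e' : Fin (n + 2) → ℝ} (he : StrictMono e)
    (he' : StrictMono e') (h₀ : e' 0 = e 0) (h₁ : e' (Fin.last _) = e (Fin.last _))
    (h : ∀ (j : Fin n) k, 0 < overlap e j.castSucc e' k → overlap e j.succ e' k ≤ 0) :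
    e' = e := by
  have hmem : ∀ j : Fin n, e j.succ.castSucc ∈ Set.range e' := fun j => by
    have hlt := he j.castSucc.castSucc_lt_succ
    have hgt := he j.succ.castSucc_lt_succ
    rw [Fin.succ_castSucc] at hlt
    refine (mem_range_or_exists_mem_Ioo (h₀.trans_le (he.monotone (Fin.zero_le _)))
      ((he.monotone (Fin.le_last _)).trans_eq h₁.symm)).resolve_right ?_
    rintro ⟨k, hk, hk'⟩
    refine (h j k (overlap_pos ?_)).not_gt (overlap_pos ?_)
    · rw [Fin.succ_castSucc]
      exact (max_lt hlt hk).trans_le (le_min le_rfl hk'.le)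
    · exact (max_le le_rfl hk.le).trans_lt (lt_min hgt hk')
  have hsub : Set.range e ⊆ Set.range e' := by
    rintro _ ⟨m, rfl⟩
    induction m using Fin.cases with
    | zero => exact ⟨0, h₀⟩
    | succ m =>
      induction m using Fin.lastCases with
      | last => exact ⟨_, h₁⟩
      | cast j => exact Fin.succ_castSucc j ▸ hmem j
  refine (he'.range_inj he).1 (Set.eq_of_subset_of_ncard_le hsub ?_ (Set.finite_range _)).symm
  rw [Set.ncard_range_of_injective he.injective, Set.ncard_range_of_injective he'.injective]

end Segmentations

section ChangePoints

variable {K : ℕ} {ε : ℝ} {ν : Fin K → ℝ}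

lemma extend_zero (ν : Fin K → ℝ) : extend ν 0 = 0 := by simp [extend]

lemma extend_last (ν : Fin K → ℝ) : extend ν (Fin.last (K + 1)) = 1 := by
  rw [← Fin.succ_last]
  simp only [extend, Fin.cons_succ, Fin.snoc_last]

lemma extend_castSucc_succ (ν : Fin K → ℝ) (k : Fin K) : extend ν k.castSucc.succ = ν k := by
  simp [extend]

lemma extend_injective : Function.Injective (extend (K := K)) := fun ν ν' h => funext fun k => by
  rw [← extend_castSucc_succ ν k, h, extend_castSucc_succ]

lemma continuous_extend : Continuous (extend (K := K)) := by
  refine continuous_pi fun k => ?_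
  induction k using Fin.cases with
  | zero => simpa only [extend_zero] using continuous_const
  | succ k =>
    induction k using Fin.lastCases with
    | last => simpa only [Fin.succ_last, extend_last] using continuous_const
    | cast k => simpa only [extend_castSucc_succ] using continuous_apply k

lemma strictMono_extend (hε : 0 ≤ ε) (hν : ν ∈ admissible K ε) : StrictMono (extend ν) :=
  Fin.strictMono_iff_lt_succ.2 fun k => sub_pos.1 (hε.trans_lt (hν.2.2 k))

lemma strictMono_extend_of_tendsto {α : Type*} {F : Filter α} [F.NeBot] (hε : 0 < ε)
    {ν' : α → Fin K → ℝ} (hν' : ∀ᶠ a in F, ν' a ∈ admissible K ε) (hlim : Tendsto ν' F (𝓝 ν)) :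
    StrictMono (extend ν) := by
  have hext := tendsto_pi_nhds.1 ((continuous_extend.tendsto ν).comp hlim)
  exact Fin.strictMono_iff_lt_succ.2 fun k => sub_pos.1 <| hε.trans_le <|
    ge_of_tendsto ((hext k.succ).sub (hext k.castSucc)) (hν'.mono fun a ha => (ha.2.2 k).le)

lemma extend_nonneg (h : Monotone (extend ν)) (k : Fin (K + 2)) : 0 ≤ extend ν k :=
  (extend_zero ν).symm.trans_le (h (Fin.zero_le k))

lemma changePoint_zero (T : ℕ) (ν : Fin K → ℝ) : changePoint T ν 0 = 0 := by
  simp [changePoint, extend_zero]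

lemma changePoint_last (T : ℕ) (ν : Fin K → ℝ) : changePoint T ν (Fin.last (K + 1)) = T := by
  simp [changePoint, extend_last]

lemma monotone_changePoint (T : ℕ) (h : Monotone (extend ν)) : Monotone (changePoint T ν) :=
  fun _ _ hkl => Nat.floor_mono (mul_le_mul_of_nonneg_left (h hkl) T.cast_nonneg)

lemma changePoint_le (T : ℕ) (h : Monotone (extend ν)) (k : Fin (K + 2)) :
    changePoint T ν k ≤ T :=
  (monotone_changePoint T h (Fin.le_last k)).trans_eq (changePoint_last T ν)

lemma interval_subset_Icc (T : ℕ) (h : Monotone (extend ν)) (k : Fin (K + 1)) :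
    interval T ν k ⊆ Finset.Icc 1 T :=
  Finset.Ioc_subset_Ioc (Nat.zero_le _) (changePoint_le T h _)

lemma card_interval (T : ℕ) (h : Monotone (extend ν)) (k : Fin (K + 1)) :
    ((interval T ν k).card : ℝ) = changePoint T ν k.succ - changePoint T ν k.castSucc := by
  rw [interval, Nat.card_Ioc, Nat.cast_sub (monotone_changePoint T h k.castSucc_lt_succ.le)]

lemma tendsto_floor_mul_div (u : ℝ) :
    Tendsto (fun T : ℕ => (⌊(T : ℝ) * u⌋₊ : ℝ) / T) atTop (𝓝 (max u 0)) := by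
  rcases le_total 0 u with hu | hu
  · rw [max_eq_left hu]
    simpa only [Function.comp_def, mul_comm u] using
      (tendsto_nat_floor_mul_div_atTop hu).comp (tendsto_natCast_atTop_atTop (R := ℝ))
  · rw [max_eq_right hu]
    refine tendsto_const_nhds.congr fun T => ?_
    rw [Nat.floor_of_nonpos (mul_nonpos_of_nonneg_of_nonpos T.cast_nonneg hu), Nat.cast_zero,
      zero_div]

/-- The time bins `t ≤ T u` of the interval `k`. -/
def binsUpTo (T : ℕ) (ν : Fin K → ℝ) (k : Fin (K + 1)) (u : ℝ) : Finset ℕ :=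
  Finset.Ioc (min ⌊(T : ℝ) * u⌋₊ (changePoint T ν k.castSucc))
    (min ⌊(T : ℝ) * u⌋₊ (changePoint T ν k.succ))

lemma binsUpTo_subset_interval (T : ℕ) (ν : Fin K → ℝ) (k : Fin (K + 1)) (u : ℝ) :
    binsUpTo T ν k u ⊆ interval T ν k := fun t ht => by
  simp only [binsUpTo, interval, Finset.mem_Ioc] at ht ⊢
  omega

lemma tendsto_card_binsUpTo_div (h : Monotone (extend ν)) (k : Fin (K + 1)) (u : ℝ) :
    Tendsto (fun T : ℕ => ((binsUpTo T ν k u).card : ℝ) / T) atTop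
      (𝓝 (lengthUpTo (extend ν) k u)) := by
  have hmin : ∀ m, Tendsto
      (fun T : ℕ => ((min ⌊(T : ℝ) * u⌋₊ (changePoint T ν m) : ℕ) : ℝ) / T) atTop
      (𝓝 (min (max u 0) (extend ν m))) := fun m => by
    have hm : Tendsto (fun T : ℕ => (changePoint T ν m : ℝ) / T) atTop (𝓝 (extend ν m)) := by
      simpa only [changePoint, max_eq_left (extend_nonneg h m)] using
        tendsto_floor_mul_div (extend ν m)
    refine ((tendsto_floor_mul_div u).min hm).congr fun T => ?_
    rw [min_div_div_right T.cast_nonneg, Nat.cast_min]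
  have hlim := (hmin k.succ).sub (hmin k.castSucc)
  have hlength : min (max u 0) (extend ν k.succ) - min (max u 0) (extend ν k.castSucc)
      = lengthUpTo (extend ν) k u := by
    have := extend_nonneg h k.succ
    have := extend_nonneg h k.castSucc
    unfold lengthUpTo
    grind
  rw [hlength] at hlim
  refine hlim.congr fun T => ?_
  rw [binsUpTo, Nat.card_Ioc, Nat.cast_sub
    (min_le_min_left _ (monotone_changePoint T h k.castSucc_lt_succ.le)), sub_div]

end ChangePoints

section CumulativeAverages

lemma sum_Ioc_eq_sub {M : Type*} [AddCommGroup M] (f : ℕ → M) {a b : ℕ} (h : a ≤ b) :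
    ∑ t ∈ Finset.Ioc a b, f t = ∑ t ∈ Finset.Ioc 0 b, f t - ∑ t ∈ Finset.Ioc 0 a, f t :=
  eq_sub_of_add_eq' (Finset.sum_Ioc_consecutive f a.zero_le h)

/-- The sum of `f t` over the time bins `0 < t ≤ T u` with `t ≤ T`, divided by `T`. -/
def cumAverage (T : ℕ) (f : ℕ → ℝ) (u : ℝ) : ℝ :=
  (∑ t ∈ Finset.Ioc 0 (min ⌊(T : ℝ) * u⌋₊ T), f t) / T

lemma monotone_cumAverage (T : ℕ) {f : ℕ → ℝ} (hf : 0 ≤ f) : Monotone (cumAverage T f) :=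
  fun _ _ huv => div_le_div_of_nonneg_right (Finset.sum_le_sum_of_subset_of_nonneg
    (Finset.Ioc_subset_Ioc_right (min_le_min_right _
      (Nat.floor_mono (mul_le_mul_of_nonneg_left huv T.cast_nonneg)))) fun t _ _ => hf t)
    T.cast_nonneg

variable {K : ℕ} {ν : Fin K → ℝ}

lemma sum_interval_div (T : ℕ) (f : ℕ → ℝ) (h : Monotone (extend ν)) (k : Fin (K + 1)) :
    (∑ t ∈ interval T ν k, f t) / T
      = cumAverage T f (extend ν k.succ) - cumAverage T f (extend ν k.castSucc) := by
  rw [interval, sum_Ioc_eq_sub f (monotone_changePoint T h k.castSucc_lt_succ.le), sub_div,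
    ← min_eq_left (changePoint_le T h k.succ), ← min_eq_left (changePoint_le T h k.castSucc)]
  rfl

lemma cumAverage_eq_sum_binsUpTo (T : ℕ) (f : ℕ → ℝ) (h : Monotone (extend ν)) (u : ℝ) :
    cumAverage T f u = ∑ k, (∑ t ∈ binsUpTo T ν k u, f t) / T := by
  simp only [← Finset.sum_div, binsUpTo, sum_Ioc_eq_sub f
    (min_le_min_left _ (monotone_changePoint T h (Fin.castSucc_lt_succ).le))]
  rw [sum_fin_succ_sub_castSucc
    fun k => ∑ t ∈ Finset.Ioc 0 (min ⌊(T : ℝ) * u⌋₊ (changePoint T ν k)), f t,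
    changePoint_zero, changePoint_last, min_zero, Finset.Ioc_self, Finset.sum_empty, sub_zero,
    cumAverage]

lemma tendsto_apply_of_monotone {α : Type*} {F : Filter α} {G : α → ℝ → ℝ} {g : ℝ → ℝ}
    {u : α → ℝ} {v : ℝ} (hG : ∀ᶠ a in F, Monotone (G a)) (hg : ContinuousAt g v)
    (h : ∀ q : ℚ, Tendsto (fun a => G a q) F (𝓝 (g q))) (hu : Tendsto u F (𝓝 v)) :
    Tendsto (fun a => G a (u a)) F (𝓝 (g v)) := by
  refine tendsto_order.2 ⟨fun x hx => ?_, fun x hx => ?_⟩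
  · obtain ⟨l, hl, hlv⟩ :=
      exists_Ioc_subset_of_mem_nhds (hg.eventually_const_lt hx) (exists_lt v)
    obtain ⟨q, hlq, hqv⟩ := exists_rat_btwn hl
    filter_upwards [hG, (h q).eventually_const_lt (hlv ⟨hlq, hqv.le⟩), hu.eventually_const_lt hqv]
      with a hmono hxq hqu using hxq.trans_le (hmono hqu.le)
  · obtain ⟨l, hl, hlv⟩ :=
      exists_Ico_subset_of_mem_nhds (hg.eventually_lt_const hx) (exists_gt v)
    obtain ⟨q, hvq, hql⟩ := exists_rat_btwn hl
    filter_upwards [hG, (h q).eventually_lt_const (hlv ⟨hvq.le, hql⟩), hu.eventually_lt_const hvq]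
      with a hmono hqx huq using (hmono huq.le).trans_lt hqx

lemma tendsto_sum_interval_div {F : Filter ℕ} {f : ℕ → ℕ → ℝ} {g : ℝ → ℝ} {ν' : ℕ → Fin K → ℝ}
    (hf : ∀ T, 0 ≤ f T) (hg : Continuous g)
    (hfg : ∀ q : ℚ, Tendsto (fun T => cumAverage T (f T) q) F (𝓝 (g q)))
    (hν' : ∀ᶠ T in F, Monotone (extend (ν' T))) (hlim : Tendsto ν' F (𝓝 ν)) (k : Fin (K + 1)) :
    Tendsto (fun T => (∑ t ∈ interval T (ν' T) k, f T t) / T) F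
      (𝓝 (g (extend ν k.succ) - g (extend ν k.castSucc))) := by
  have hext := tendsto_pi_nhds.1 ((continuous_extend.tendsto ν).comp hlim)
  have hcum : ∀ m, Tendsto (fun T => cumAverage T (f T) (extend (ν' T) m)) F
      (𝓝 (g (extend ν m))) := fun m =>
    tendsto_apply_of_monotone (.of_forall fun T => monotone_cumAverage T (hf T)) hg.continuousAt
      hfg (hext m)
  exact ((hcum k.succ).sub (hcum k.castSucc)).congr'
    (hν'.mono fun T hT => (sum_interval_div T (f T) hT k).symm)

end CumulativeAverages

namespace Model

variable {n₁ n₂ W : ℕ}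

/-- The rate `μ_{R(i),w}` of the pixel `i` in the band `w`, as a function of the pair `(i, w)`. -/
def rate (ψ : Model n₁ n₂ W) (p : Pixel n₁ n₂ × Fin W) : ℝ := ψ.μ (ψ.R p.1) p.2

lemma rate_pos (ψ : Model n₁ n₂ W) (p : Pixel n₁ n₂ × Fin W) : 0 < ψ.rate p := ψ.μ_pos _ _

lemma integral_poissonMeasure_rate (ψ : Model n₁ n₂ W) (p : Pixel n₁ n₂ × Fin W) :
    ∫ n : ℕ, (n : ℝ) ∂poissonMeasure (ψ.rate p).toNNReal = ψ.rate p := by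
  rw [integral_natCast_poissonMeasure, Real.coe_toNNReal _ (ψ.rate_pos p).le]

lemma logLik_eq_sum_poissonLogLik (ψ : Model n₁ n₂ W) (x : Pixel n₁ n₂ → Fin W → ℕ) :
    ψ.logLik x = ∑ p : Pixel n₁ n₂ × Fin W, poissonLogLik 1 (x p.1 p.2) (ψ.rate p) := by
  rw [Fintype.sum_prod_type_right, logLik]
  refine Finset.sum_congr rfl fun w _ => ?_
  rw [← Finset.sum_fiberwise (s := Finset.univ) (g := ψ.R)]
  refine Finset.sum_congr rfl fun h _ => Finset.sum_congr rfl fun i hi => ?_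
  simp only [poissonLogLik, rate, (Finset.mem_filter.1 hi).2, one_mul]

lemma sum_logLik (ψ : Model n₁ n₂ W) (s : Finset ℕ) (Y : ℕ → Pixel n₁ n₂ → Fin W → ℕ) :
    ∑ t ∈ s, ψ.logLik (Y t) = ∑ p : Pixel n₁ n₂ × Fin W,
      poissonLogLik s.card (∑ t ∈ s, (Y t p.1 p.2 : ℝ)) (ψ.rate p) := by
  simp only [logLik_eq_sum_poissonLogLik, Finset.card_eq_sum_ones, Nat.cast_sum, Nat.cast_one,
    poissonLogLik_sum]
  exact Finset.sum_comm

lemma area_pos (ψ : Model n₁ n₂ W) (h : Fin ψ.m) : 0 < ψ.area h := by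
  obtain ⟨i, hi⟩ := (ψ.connected h).nonempty
  exact Finset.card_pos.2 ⟨i, Finset.mem_filter.2 ⟨Finset.mem_univ i, hi⟩⟩

lemma oversegments_of_adj {b s : Model n₁ n₂ W}
    (h : ∀ i j, (grid n₁ n₂).Adj i j → s.R i ≠ s.R j → b.R i ≠ b.R j) : b.Oversegments s := by
  intro i j hij
  have hreach := (b.connected (b.R j)).preconnected ⟨i, hij⟩ ⟨j, rfl⟩
  have hwalk : ∀ {c d} (_ : ((grid n₁ n₂).induce {i | b.R i = b.R j}).Walk c d), s.R c = s.R d := by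
    intro c d w
    induction w with
    | nil => rfl
    | @cons c v _ hcv _ ih =>
      exact (not_imp_not.1 (h c v hcv) (c.2.trans v.2.symm)).trans ih
  exact hreach.elim hwalk

lemma eventually_oversegments {α : Type*} {F : Filter α} {b : α → Model n₁ n₂ W}
    {s : Model n₁ n₂ W}
    (hregions : ∀ p q, s.NeighbouringRegions p q → ∃ w, s.μ p w ≠ s.μ q w)
    (hb : ∀ p, Tendsto (fun a => (b a).rate p) F (𝓝 (s.rate p))) :
    ∀ᶠ a in F, (b a).Oversegments s := by
  have hsep : ∀ᶠ a in F, ∀ i j, (grid n₁ n₂).Adj i j ∧ s.R i ≠ s.R j → (b a).R i ≠ (b a).R j := by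
    refine eventually_all.2 fun i => eventually_all.2 fun j =>
      eventually_imp_distrib_left.2 fun ⟨hadj, hne⟩ => ?_
    obtain ⟨w, hw⟩ := hregions _ _ ⟨hne, i, j, hadj, rfl, rfl⟩
    filter_upwards [((hb (i, w)).sub (hb (j, w))).eventually_ne (sub_ne_zero.2 hw)] with a ha heq
    exact ha (by simp only [rate, heq, sub_self])
  exact hsep.mono fun a ha => oversegments_of_adj fun i j hadj hne => ha i j ⟨hadj, hne⟩

end Model

section Penalty

variable {n₁ n₂ W K : ℕ}

lemma tendsto_log_natCast_add_one_div :
    Tendsto (fun T : ℕ => Real.log ((T : ℝ) + 1) / T) atTop (𝓝 0) := by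
  have hadd : Tendsto (fun T : ℕ => (T : ℝ) + 1) atTop atTop :=
    tendsto_atTop_add_const_right _ _ tendsto_natCast_atTop_atTop
  have hlim : Tendsto (fun T : ℕ => Real.log ((T : ℝ) + 1) / (1 * ((T : ℝ) + 1) + -1)) atTop
      (𝓝 0) := by
    simpa only [Function.comp_def, pow_one] using
      (Real.tendsto_pow_log_div_mul_add_atTop 1 (-1) 1 one_ne_zero).comp hadd
  exact hlim.congr fun T => by rw [one_mul, add_neg_cancel_right]

lemma penalty_nonneg (ψ : Model n₁ n₂ W) {len : ℝ} (hlen : 0 ≤ len) : 0 ≤ penalty ψ len := by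
  have hareas : 0 ≤ ∑ h, Real.log ((len + 1) * (ψ.area h : ℝ)) := Finset.sum_nonneg fun h _ =>
    Real.log_nonneg (one_le_mul_of_one_le_of_one_le (by linarith)
      (Nat.one_le_cast.2 (ψ.area_pos h)))
  unfold penalty
  positivity

lemma penalty_eq_add_log (ψ : Model n₁ n₂ W) {len : ℝ} (hlen : 0 ≤ len) :
    penalty ψ len = penalty ψ 0 + (W : ℝ) / 2 * ψ.m * Real.log (len + 1) := by
  have hlog : ∀ h, Real.log ((len + 1) * (ψ.area h : ℝ))
      = Real.log ((0 + 1) * (ψ.area h : ℝ)) + Real.log (len + 1) := fun h => by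
    have harea : (ψ.area h : ℝ) ≠ 0 := Nat.cast_ne_zero.2 (ψ.area_pos h).ne'
    rw [Real.log_mul (by linarith) harea, zero_add, one_mul, add_comm]
  simp only [penalty, hlog, Finset.sum_add_distrib, Finset.sum_const, Finset.card_univ,
    Fintype.card_fin, nsmul_eq_mul]
  ring

/-- The code length of all the models of a segmentation. -/
def totalPenalty (T : ℕ) (ν : Fin K → ℝ) (ψ : Fin (K + 1) → Model n₁ n₂ W) : ℝ :=
  ∑ k, penalty (ψ k) (changePoint T ν k.succ - changePoint T ν k.castSucc)

variable {ν : Fin K → ℝ}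

lemma totalPenalty_nonneg (T : ℕ) (h : Monotone (extend ν)) (ψ : Fin (K + 1) → Model n₁ n₂ W) :
    0 ≤ totalPenalty T ν ψ :=
  Finset.sum_nonneg fun k _ => penalty_nonneg _ <| by
    rw [← card_interval T h]
    exact Nat.cast_nonneg _

lemma tendsto_totalPenalty_div (h : Monotone (extend ν)) (ψ : Fin (K + 1) → Model n₁ n₂ W) :
    Tendsto (fun T : ℕ => totalPenalty T ν ψ / T) atTop (𝓝 0) := by
  simp only [totalPenalty, Finset.sum_div, ← card_interval _ h]
  rw [← Finset.sum_const_zero (s := (Finset.univ : Finset (Fin (K + 1))))]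
  refine tendsto_finsetSum _ fun k _ => ?_
  have hlog : Tendsto (fun T : ℕ => Real.log ((interval T ν k).card + 1 : ℝ) / T) atTop (𝓝 0) := by
    refine squeeze_zero (fun T => div_nonneg (Real.log_nonneg (by simp)) T.cast_nonneg)
      (fun T => ?_) tendsto_log_natCast_add_one_div
    have hcard : (interval T ν k).card ≤ T := by
      simpa using Finset.card_le_card (interval_subset_Icc T h k)
    gcongr
  have hlim := (tendsto_const_div_atTop_nhds_zero_nat (penalty (ψ k) 0)).add
    (hlog.const_mul ((W : ℝ) / 2 * (ψ k).m))
  rw [mul_zero, add_zero] at hlim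
  refine hlim.congr fun T => ?_
  rw [penalty_eq_add_log _ (Nat.cast_nonneg _), add_div, mul_div_assoc]

end Penalty

section AverageLikelihood

variable {n₁ n₂ W K : ℕ}

/-- The log-likelihood of the images `Y t`, `1 ≤ t ≤ T`, divided by `T`. -/
def avgLogLik (T : ℕ) (Y : ℕ → Pixel n₁ n₂ → Fin W → ℕ) (ν : Fin K → ℝ)
    (ψ : Fin (K + 1) → Model n₁ n₂ W) : ℝ :=
  (∑ k, ∑ t ∈ interval T ν k, (ψ k).logLik (Y t)) / T

variable {T : ℕ} {Y : ℕ → Pixel n₁ n₂ → Fin W → ℕ} {ν νo : Fin K → ℝ}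
  {ψ ψo : Fin (K + 1) → Model n₁ n₂ W}

lemma avgLogLik_eq_sum_poissonLogLik :
    avgLogLik T Y ν ψ = ∑ c : Fin (K + 1) × Pixel n₁ n₂ × Fin W,
      poissonLogLik ((interval T ν c.1).card / T)
        ((∑ t ∈ interval T ν c.1, (Y t c.2.1 c.2.2 : ℝ)) / T) ((ψ c.1).rate c.2) := by
  simp only [avgLogLik, Model.sum_logLik, Finset.sum_div, Fintype.sum_prod_type, poissonLogLik]
  simp only [sub_div, Finset.sum_mul, Finset.sum_div, div_mul_eq_mul_div]

lemma sub_totalPenalty_div_le_avgLogLik (hν : Monotone (extend ν))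
    (h : mdl T Y ν ψ ≤ mdl T Y νo ψo) :
    avgLogLik T Y νo ψo - totalPenalty T νo ψo / T ≤ avgLogLik T Y ν ψ := by
  have hpen := totalPenalty_nonneg T hν ψ
  rw [avgLogLik, avgLogLik, ← sub_div]
  refine div_le_div_of_nonneg_right ?_ T.cast_nonneg
  unfold mdl at h
  unfold totalPenalty at hpen ⊢
  linarith

lemma IsMDLEstimate.mdl_le {ε : ℝ} {𝓜 : Set (Model n₁ n₂ W)} (hT : 0 < T)
    (h : IsMDLEstimate ε 𝓜 T Y ν ψ) (hνo : νo ∈ admissible K ε) (hψo : ∀ k, ψo k ∈ 𝓜) :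
    mdl T Y ν ψ ≤ mdl T Y νo ψo :=
  le_of_mul_le_mul_left (h.2 νo hνo ψo hψo) (one_div_pos.2 (Nat.cast_pos.2 hT))

end AverageLikelihood

section Consistency

variable {n₁ n₂ W K : ℕ} {ε : ℝ} {νo νs : Fin K → ℝ} {ψo : Fin (K + 1) → Model n₁ n₂ W}
  {Y : ℕ → ℕ → Pixel n₁ n₂ → Fin W → ℕ} {F : Filter ℕ} {ν : ℕ → Fin K → ℝ}
  {ψ : ℕ → Fin (K + 1) → Model n₁ n₂ W}

/-- The images `Y T t` obey the law of large numbers for the change points `νo` and the rates of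
`ψo`. The times are rational so that the property holds almost surely; it extends to all real times,
as the cumulative counts are monotone. -/
def HasAverages (νo : Fin K → ℝ) (ψo : Fin (K + 1) → Model n₁ n₂ W)
    (Y : ℕ → ℕ → Pixel n₁ n₂ → Fin W → ℕ) : Prop :=
  ∀ (p : Pixel n₁ n₂ × Fin W) (q : ℚ),
    Tendsto (fun T => cumAverage T (fun t => (Y T t p.1 p.2 : ℝ)) q) atTop
      (𝓝 (∑ j, lengthUpTo (extend νo) j q * (ψo j).rate p))

lemma tendsto_card_interval_div (hF : F ≤ atTop) (ho : Monotone (extend νo))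
    (hν : ∀ᶠ T in F, Monotone (extend (ν T))) (hlim : Tendsto ν F (𝓝 νs)) (k : Fin (K + 1)) :
    Tendsto (fun T => ((interval T (ν T) k).card : ℝ) / T) F
      (𝓝 (∑ j, overlap (extend νo) j (extend νs) k)) := by
  have hcum : ∀ q : ℚ, Tendsto (fun T => cumAverage T (fun _ => 1) q) atTop
      (𝓝 (∑ j, lengthUpTo (extend νo) j q)) := fun q => by
    simpa only [cumAverage_eq_sum_binsUpTo _ _ ho, Finset.sum_const, nsmul_eq_mul, mul_one] using
      tendsto_finsetSum Finset.univ fun j _ => tendsto_card_binsUpTo_div ho j (q : ℝ)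
  simpa only [Finset.sum_const, nsmul_eq_mul, mul_one, overlap, Finset.sum_sub_distrib] using
    tendsto_sum_interval_div (f := fun _ _ => 1) (fun _ _ => zero_le_one)
      (continuous_finsetSum _ fun j _ => continuous_lengthUpTo (extend νo) j)
      (fun q => (hcum q).mono_left hF) hν hlim k

lemma HasAverages.tendsto_sum_interval_div (hY : HasAverages νo ψo Y) (hF : F ≤ atTop)
    (hν : ∀ᶠ T in F, Monotone (extend (ν T))) (hlim : Tendsto ν F (𝓝 νs)) (k : Fin (K + 1))
    (p : Pixel n₁ n₂ × Fin W) :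
    Tendsto (fun T => (∑ t ∈ interval T (ν T) k, (Y T t p.1 p.2 : ℝ)) / T) F
      (𝓝 (∑ j, overlap (extend νo) j (extend νs) k * (ψo j).rate p)) := by
  simpa only [overlap, sub_mul, Finset.sum_sub_distrib] using
    ImageSeries.tendsto_sum_interval_div (f := fun T t => (Y T t p.1 p.2 : ℝ))
      (fun _ _ => Nat.cast_nonneg _)
      (continuous_finsetSum _ fun j _ =>
        (continuous_lengthUpTo (extend νo) j).mul_const ((ψo j).rate p))
      (fun q => (hY p q).mono_left hF) hν hlim k

lemma HasAverages.tendsto_avgLogLik (hY : HasAverages νo ψo Y) (ho : Monotone (extend νo)) :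
    Tendsto (fun T => avgLogLik T (Y T) νo ψo) atTop
      (𝓝 (∑ j, ∑ p, poissonLogLik (extend νo j.succ - extend νo j.castSucc)
        ((extend νo j.succ - extend νo j.castSucc) * (ψo j).rate p) ((ψo j).rate p))) := by
  simp only [avgLogLik_eq_sum_poissonLogLik]
  rw [← Fintype.sum_prod_type']
  refine tendsto_finsetSum _ fun c _ => ?_
  have hcard := tendsto_card_interval_div le_rfl ho (.of_forall fun _ => ho) tendsto_const_nhds c.1
  have hcount := hY.tendsto_sum_interval_div le_rfl (.of_forall fun _ => ho) tendsto_const_nhds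
    c.1 c.2
  simp only [overlap_self ho, Finset.sum_ite_eq', Finset.mem_univ, if_true, ite_mul, zero_mul]
    at hcard hcount
  exact (hcount.mul_const _).sub (hcard.mul_const _)

lemma sum_poissonLogLik_overlap (ho : Monotone (extend νo)) (νs : Fin K → ℝ)
    (lam : Fin (K + 1) → Pixel n₁ n₂ × Fin W → ℝ) :
    ∑ c : Fin (K + 1) × Pixel n₁ n₂ × Fin W, ∑ j,
      poissonLogLik (overlap (extend νo) j (extend νs) c.1)
        (overlap (extend νo) j (extend νs) c.1 * lam j c.2) (lam j c.2)
      = ∑ j, ∑ p, poissonLogLik (extend νo j.succ - extend νo j.castSucc)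
        ((extend νo j.succ - extend νo j.castSucc) * lam j p) (lam j p) := by
  have hlen := sum_overlap_right (e' := extend νs) ho
    (by rw [extend_zero, extend_zero]) (by rw [extend_last, extend_last])
  rw [Finset.sum_comm]
  refine Finset.sum_congr rfl fun j _ => ?_
  rw [Fintype.sum_prod_type_right]
  refine Finset.sum_congr rfl fun p _ => ?_
  simp only [← poissonLogLik_sum, ← Finset.sum_mul, hlen]

lemma HasAverages.tendsto_rate [F.NeBot] (hY : HasAverages νo ψo Y) (ho : Monotone (extend νo))
    (hF : F ≤ atTop) (hν : ∀ᶠ T in F, Monotone (extend (ν T))) (hlim : Tendsto ν F (𝓝 νs))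
    (hs : StrictMono (extend νs))
    (hmdl : ∀ᶠ T in F, mdl T (Y T) (ν T) (ψ T) ≤ mdl T (Y T) νo ψo) {j k : Fin (K + 1)}
    (hjk : 0 < overlap (extend νo) j (extend νs) k) (p : Pixel n₁ n₂ × Fin W) :
    Tendsto (fun T => (ψ T k).rate p) F (𝓝 ((ψo j).rate p)) := by
  have hB := (hY.tendsto_avgLogLik ho).sub (tendsto_totalPenalty_div ho ψo)
  rw [sub_zero, ← sum_poissonLogLik_overlap ho νs fun j => (ψo j).rate] at hB
  have hlen := sum_overlap (e := extend νo) hs.monotone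
    (by rw [extend_zero, extend_zero]) (by rw [extend_last, extend_last])
  refine tendsto_rate_of_le_sum_poissonLogLik_of_mixture (F := F)
    (ι := Fin (K + 1) × Pixel n₁ n₂ × Fin W)
    (o := fun c j => overlap (extend νo) j (extend νs) c.1) (lam := fun c j => (ψo j).rate c.2)
    (r := fun T c => (ψ T c.1).rate c.2) (i := (k, p))
    (fun c j => overlap_nonneg ho hs.monotone j c.1) (fun c j => (ψo j).rate_pos c.2)
    (fun c => (hlen c.1).symm ▸ sub_pos.2 (hs c.1.castSucc_lt_succ))
    (fun c => tendsto_card_interval_div hF ho hν hlim c.1)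
    (fun c => hY.tendsto_sum_interval_div hF hν hlim c.1 c.2)
    (.of_forall fun T c => (ψ T c.1).rate_pos c.2) (hB.mono_left hF) ?_ hjk
  filter_upwards [hν, hmdl] with T hνT hT
  exact (sub_totalPenalty_div_le_avgLogLik hνT hT).trans_eq avgLogLik_eq_sum_poissonLogLik

theorem HasAverages.tendsto_changePoints (hY : HasAverages νo ψo Y) (hε : 0 < ε)
    (hνo : νo ∈ admissible K ε)
    (hintervals : ∀ k : Fin K, ∃ p, (ψo k.succ).rate p ≠ (ψo k.castSucc).rate p)
    (hest : ∀ᶠ T in atTop, ν T ∈ admissible K ε ∧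
      mdl T (Y T) (ν T) (ψ T) ≤ mdl T (Y T) νo ψo) :
    Tendsto ν atTop (𝓝 νo) := by
  have ho := strictMono_extend hε.le hνo
  refine (tendsto_iff_ultrafilter _ _ _).2 fun U hU => ?_
  have hestU := hest.filter_mono hU
  have hmem : ∀ᶠ T in (U : Filter ℕ), ν T ∈ Set.Icc (0 : Fin K → ℝ) 1 :=
    hestU.mono fun T hT => ⟨fun k => (hT.1.1 k).1.le, fun k => (hT.1.1 k).2.le⟩
  obtain ⟨νs, -, hlim⟩ : ∃ νs ∈ Set.Icc (0 : Fin K → ℝ) 1, Tendsto ν U (𝓝 νs) :=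
    isCompact_Icc.ultrafilter_le_nhds (U.map ν) (le_principal_iff.2 hmem)
  have hs := strictMono_extend_of_tendsto hε (hestU.mono fun T hT => hT.1) hlim
  have hrate : ∀ {j k}, 0 < overlap (extend νo) j (extend νs) k → ∀ p,
      Tendsto (fun T => (ψ T k).rate p) U (𝓝 ((ψo j).rate p)) :=
    hY.tendsto_rate ho.monotone hU
      (hestU.mono fun T hT => (strictMono_extend hε.le hT.1).monotone) hlim hs
      (hestU.mono fun T hT => hT.2)
  have heq : extend νs = extend νo := eq_of_forall_overlap_nonpos ho hs
    (by rw [extend_zero, extend_zero]) (by rw [extend_last, extend_last])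
    fun j k hleft => by
      obtain ⟨p, hp⟩ := hintervals j
      exact not_lt.1 fun hright => hp (tendsto_nhds_unique (hrate hright p) (hrate hleft p))
  rwa [extend_injective heq] at hlim

theorem HasAverages.eventually_oversegments (hY : HasAverages νo ψo Y) (ho : StrictMono (extend νo))
    (hregions : ∀ k p q, (ψo k).NeighbouringRegions p q → ∃ w, (ψo k).μ p w ≠ (ψo k).μ q w)
    (hν : ∀ᶠ T in atTop, Monotone (extend (ν T))) (hlim : Tendsto ν atTop (𝓝 νo))
    (hmdl : ∀ᶠ T in atTop, mdl T (Y T) (ν T) (ψ T) ≤ mdl T (Y T) νo ψo) :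
    ∀ᶠ T in atTop, ∀ k, (ψ T k).Oversegments (ψo k) := by
  refine eventually_all.2 fun k => Model.eventually_oversegments (hregions k)
    (hY.tendsto_rate ho.monotone le_rfl hν hlim ho hmdl ?_)
  rw [overlap_self ho.monotone, if_pos rfl]
  exact sub_pos.2 (ho k.castSucc_lt_succ)

end Consistency

section AlmostSure

variable {Ω : Type*} [MeasurableSpace Ω] {P : Measure Ω} {n₁ n₂ W K : ℕ}
  {νo : Fin K → ℝ} {ψo : Fin (K + 1) → Model n₁ n₂ W} {y : ℕ → ℕ → Pixel n₁ n₂ → Fin W → Ω → ℕ}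
  {η : Fin (K + 1) → Pixel n₁ n₂ → Fin W → Measure ℕ}

lemma ae_hasAverages [IsProbabilityMeasure P] [∀ k i w, IsProbabilityMeasure (η k i w)]
    (hη : ∀ k i w, 0 ∈ interior (integrableExpSet (fun n : ℕ => (n : ℝ)) (η k i w)))
    (hmean : ∀ k i w, ∫ n, (n : ℝ) ∂η k i w = (ψo k).rate (i, w)) (ho : Monotone (extend νo))
    (hind : ∀ T i w, iIndepFun (fun t : Finset.Icc 1 T => y T t i w) P)
    (hlaw : ∀ T k, ∀ t ∈ interval T νo k, ∀ i w, HasLaw (y T t i w) (η k i w) P) :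
    ∀ᵐ ω ∂P, HasAverages νo ψo fun T t i w => y T t i w ω := by
  refine ae_all_iff.2 fun ⟨i, w⟩ => ae_all_iff.2 fun q => ?_
  have hsub : ∀ T k, binsUpTo T νo k q ⊆ Finset.Icc 1 T := fun T k =>
    (binsUpTo_subset_interval T νo k q).trans (interval_subset_Icc T ho k)
  have hident : ∀ T k, ∀ t ∈ interval T νo k, IdentDistrib (y T t i w) id P (η k i w) :=
    fun T k t ht => ⟨(hlaw T k t ht i w).aemeasurable, aemeasurable_id,
      (hlaw T k t ht i w).map_eq.trans Measure.map_id.symm⟩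
  have hlln : ∀ k, ∀ᵐ ω ∂P, Tendsto (fun T : ℕ => (∑ t ∈ binsUpTo T νo k q, (y T t i w ω : ℝ)
      - (binsUpTo T νo k q).card * ∫ n, (n : ℝ) ∂η k i w) / T) atTop (𝓝 0) := fun k =>
    ae_tendsto_sum_sub_div (Z := fun T t ω => (y T t i w ω : ℝ)) (hη k i w)
      (fun T => ((hind T i w).precomp (Set.inclusion_injective (hsub T k))).comp
        (fun _ n => (n : ℝ)) fun _ => measurable_from_top)
      (fun T t ht => (hident T k t (binsUpTo_subset_interval T νo k q ht)).comp
        measurable_from_top)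
      fun T => by simpa using Finset.card_le_card (hsub T k)
  filter_upwards [ae_all_iff.2 hlln] with ω hω
  simp only [cumAverage_eq_sum_binsUpTo _ _ ho]
  refine tendsto_finsetSum _ fun k _ => ?_
  have hlim := (hω k).add ((tendsto_card_binsUpTo_div ho k q).mul_const ((ψo k).rate (i, w)))
  rw [zero_add] at hlim
  refine hlim.congr fun T => ?_
  rw [hmean]
  ring

lemma IsObserved.indep_bins (hy : IsObserved P νo ψo y) (T : ℕ) (i : Pixel n₁ n₂) (w : Fin W) :
    iIndepFun (fun t : Finset.Icc 1 T => y T t i w) P :=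
  (hy.indep T).precomp (Prod.mk_left_injective (i, w))

end AlmostSure

end ImageSeries

end

open MeasureTheory ProbabilityTheory Filter Topology ImageSeries in
theorem theorem1_general {Ω : Type*} [MeasurableSpace Ω] {P : Measure Ω} [IsProbabilityMeasure P]
    {n₁ n₂ W K : ℕ} {ε : ℝ} (hε : 0 < ε) {νo : Fin K → ℝ} (hνo : νo ∈ admissible K ε)
    {ψo : Fin (K + 1) → Model n₁ n₂ W}
    (hregions : ∀ k p q, (ψo k).NeighbouringRegions p q → ∃ w, (ψo k).μ p w ≠ (ψo k).μ q w)
    (hintervals : ∀ k : Fin K, ∃ p, (ψo k.succ).rate p ≠ (ψo k.castSucc).rate p)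
    {η : Fin (K + 1) → Pixel n₁ n₂ → Fin W → Measure ℕ} [∀ k i w, IsProbabilityMeasure (η k i w)]
    (hη : ∀ k i w, 0 ∈ interior (integrableExpSet (fun n : ℕ => (n : ℝ)) (η k i w)))
    (hmean : ∀ k i w, ∫ n, (n : ℝ) ∂η k i w = (ψo k).rate (i, w))
    {y : ℕ → ℕ → Pixel n₁ n₂ → Fin W → Ω → ℕ}
    (hind : ∀ T i w, iIndepFun (fun t : Finset.Icc 1 T => y T t i w) P)
    (hlaw : ∀ T k, ∀ t ∈ interval T νo k, ∀ i w, HasLaw (y T t i w) (η k i w) P)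
    {νhat : ℕ → Ω → Fin K → ℝ} {ψhat : ℕ → Ω → Fin (K + 1) → Model n₁ n₂ W}
    (hhat : ∀ᵐ ω ∂P, ∀ᶠ T in atTop, νhat T ω ∈ admissible K ε ∧
      mdl T (fun t i w => y T t i w ω) (νhat T ω) (ψhat T ω)
        ≤ mdl T (fun t i w => y T t i w ω) νo ψo) :
    ∀ᵐ ω ∂P, Tendsto (fun T => νhat T ω) atTop (𝓝 νo) ∧
      ∀ᶠ T in atTop, ∀ k, (ψhat T ω k).Oversegments (ψo k) := by
  have ho := strictMono_extend hε.le hνo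
  filter_upwards [ae_hasAverages hη hmean ho.monotone hind hlaw, hhat] with ω hω hest
  have hlim := hω.tendsto_changePoints hε hνo hintervals hest
  exact ⟨hlim, hω.eventually_oversegments ho hregions
    (hest.mono fun T hT => (strictMono_extend hε.le hT.1).monotone) hlim
    (hest.mono fun T hT => hT.2)⟩

open MeasureTheory ProbabilityTheory Filter Topology ImageSeries in
theorem theorem1 {Ω : Type*} [MeasurableSpace Ω] (P : Measure Ω) [IsProbabilityMeasure P]
    (n₁ n₂ W K : ℕ) (hW : 0 < W)
    (ε : ℝ) (hε : 0 < ε)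
    -- the class of models, the true change points and the true models
    (𝓜 : Set (Model n₁ n₂ W))
    (νo : Fin K → ℝ) (hνo : νo ∈ admissible K ε)
    (ψo : Fin (K + 1) → Model n₁ n₂ W) (hψo : ∀ k, ψo k ∈ 𝓜)
    -- neighbouring regions have different rates in every band
    (hregions : ∀ k p q, (ψo k).NeighbouringRegions p q →
      ∀ w, 0 < |(ψo k).μ p w - (ψo k).μ q w|)
    -- the images of two neighbouring intervals are different
    (hintervals : ∀ k : Fin K, ∃ i w,
      0 < |(ψo k.succ).μ ((ψo k.succ).R i) w - (ψo k.castSucc).μ ((ψo k.castSucc).R i) w|)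
    -- the data
    (y : ℕ → ℕ → Pixel n₁ n₂ → Fin W → Ω → ℕ) (hy : IsObserved P νo ψo y)
    -- the estimates
    (νhat : ℕ → Ω → Fin K → ℝ) (ψhat : ℕ → Ω → Fin (K + 1) → Model n₁ n₂ W)
    (hhat : ∀ᵐ ω ∂P, ∀ᶠ T in atTop,
      IsMDLEstimate ε 𝓜 T (fun t i w => y T t i w ω) (νhat T ω) (ψhat T ω)) :
    ∀ᵐ ω ∂P, Tendsto (fun T => νhat T ω) atTop (𝓝 νo) ∧
      ∀ᶠ T in atTop, ∀ k, (ψhat T ω k).Oversegments (ψo k) :=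
  theorem1_general hε hνo
    (fun k p q h => ⟨⟨0, hW⟩, sub_ne_zero.1 (abs_pos.1 (hregions k p q h _))⟩)
    (fun k => let ⟨i, w, h⟩ := hintervals k; ⟨(i, w), sub_ne_zero.1 (abs_pos.1 h)⟩)
    (fun _ _ _ => zero_mem_interior_integrableExpSet_poissonMeasure _)
    (fun k i w => (ψo k).integral_poissonMeasure_rate (i, w)) hy.indep_bins hy.law
    (hhat.mono fun _ h => (h.and (eventually_gt_atTop 0)).mono fun _ ⟨hest, hT⟩ =>
      ⟨hest.1.1, hest.mdl_le hT hνo hψo⟩)
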